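/- Let $N=(N_t)_{t\ge 0}$ be a non-homogeneous Poisson process on a probability space $(\Omega,\mathcal F,\mathbb P)$ with continuous intensity function $\lambda:[0,\infty)\to[0,\infty)$, i.e. a counting process with independent increments such that, for $0\le s\le t$, $N_t-N_s$ is Poisson distributed with mean $\int_s^t\lambda(u)\,du$. Suppose that there are $\tau^*>0$ and $m>0$ such that $\lambda(t)=m$ for all $t\ge\tau^*$. For $k\ge 1$ let $T_k=\inf\{t\ge0: N_t\ge k\}$ be the $k$-th jump time of $N$, and let $G$ be its limit distribution function, $$G(h)=\lim_{t\to\infty}\mathbb P(t<T_k\le t+h\mid T_k>t),\qquad h\ge 0 .$$ For $\tau>\tau^*$ put $$\widehat m_\tau=\frac{N_\tau-N_{\tau^*}}{\tau-\tau^*},\qquad \widehat G_\tau(h)=1-\exp(-\widehat m_\tau h),\quad h\ge 0 .$$ Then the limit defining $G$ exists with $G(h)=1-e^{-mh}$ for all $h\ge0$ (for every $k$), and $$\sup_{h\ge0}\bigl|\sqrt{\tau}\,\bigl(\widehat G_\tau(h)-G(h)\bigr)\bigr|$$ is almost surely finite for all $\tau>\tau^*$ and converges in distribution, as $\tau\to\infty$,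 to $|Z|$, where $Z$ is a normal random variable with mean $0$ and variance $e^{-2}/m$. -/

import Mathlib

open MeasureTheory ProbabilityTheory Filter Topology
open scoped NNReal

namespace Seismic

noncomputable section

/-- The cumulative intensity function `Λ(t) = ∫₀ᵗ lam(u) du` of an intensity function `lam`
on `[0, ∞)`. -/
def cumIntensity (lam : ℝ≥0 → ℝ≥0) (t : ℝ≥0) : ℝ≥0 :=
  Real.toNNReal (∫ u in (0 : ℝ)..(t : ℝ), (lam u.toNNReal : ℝ))

/-- `N` is a (non-homogeneous) Poisson process on `[0, ∞)` with intensity function `lam`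
under `μ`: almost all paths are counting paths (null at `0`, nondecreasing and right-continuous
with values in `ℕ`), the increments over successive intervals are independent, and
`N_t - N_s` has the Poisson law with mean `Λ(t) - Λ(s)`. -/
structure IsPoissonProcess {Ω : Type*} [MeasurableSpace Ω] (N : ℝ≥0 → Ω → ℕ)
    (lam : ℝ≥0 → ℝ≥0) (μ : Measure Ω) : Prop where
  measurable : ∀ t, Measurable (N t)
  zero : ∀ᵐ ω ∂μ, N 0 ω = 0
  monotone : ∀ᵐ ω ∂μ, Monotone fun t => N t ω
  rightContinuous : ∀ᵐ ω ∂μ, ∀ t, ContinuousWithinAt (fun s => N s ω) (Set.Ici t) t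
  indepIncrements : HasIndepIncrements N μ
  increment_law : ∀ s t, s ≤ t →
    HasLaw (fun ω => N t ω - N s ω)
      (poissonMeasure (cumIntensity lam t - cumIntensity lam s)) μ

/-- The `k`-th jump time `T_k = inf {t ≥ 0 : N_t ≥ k}` of a counting process. (If fewer than `k`
events ever occur the value is `0` by convention; this has probability zero when the cumulative
intensity is unbounded.) -/
def jumpTime {Ω : Type*} (N : ℝ≥0 → Ω → ℕ) (k : ℕ) (ω : Ω) : ℝ≥0 :=
  sInf {t : ℝ≥0 | k ≤ N t ω}

/-- `F_t(h) = ℙ(t < T ≤ t + h | T > t)`. -/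
def residualCDF {Ω : Type*} [MeasurableSpace Ω] (μ : Measure Ω) (T : Ω → ℝ≥0)
    (t h : ℝ≥0) : ℝ :=
  (μ[|{ω | t < T ω}]).real {ω | t < T ω ∧ T ω ≤ t + h}

/-- The limit CDF of `T`: `G(h) = lim_{t → ∞} F_t(h)`. -/
def limitCDF {Ω : Type*} [MeasurableSpace Ω] (μ : Measure Ω) (T : Ω → ℝ≥0) (h : ℝ≥0) : ℝ :=
  limUnder atTop fun t : ℝ≥0 => residualCDF μ T t h

/-- The estimator `m̂_τ = (N_τ - N_{τ*}) / (τ - τ*)` of the asymptotic slope (meant for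
`τ > τ*`). -/
def slopeEstimator {Ω : Type*} (N : ℝ≥0 → Ω → ℕ) (τs τ : ℝ≥0) (ω : Ω) : ℝ :=
  ((N τ ω : ℝ) - (N τs ω : ℝ)) / ((τ : ℝ) - (τs : ℝ))

/-- The random CDF `Ĝ_τ(h) = 1 - exp(-m̂_τ h)`. -/
def randomCDF {Ω : Type*} (N : ℝ≥0 → Ω → ℕ) (τs τ : ℝ≥0) (h : ℝ≥0) (ω : Ω) : ℝ :=
  1 - Real.exp (-(slopeEstimator N τs τ ω * (h : ℝ)))

end

end Seismic

/-! Since `T_k > t` means `N_t < k`, its probability is `exp (-Λ)` times a truncated exponential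
series at `Λ = Λ(t)`. Past `τ*`, `Λ` grows linearly with slope `m`; the polynomial factors cancel in
the limit (`tendsto_truncExp_add_div`), leaving the exponential law.

For the fluctuations, the `x`-derivative of `1 - exp (-x h)` at `m` is `h exp (-m h)`, with maximum
`e⁻¹ / m` at `h = 1 / m`. So the sup distance is `e⁻¹ / m * |m̂ - m|` times a ratio tending to `1`
as `m̂ → m` (`tendsto_expCDFDistRatio`). The Poisson central limit theorem gives `√τ (m̂ - m)`
limiting variance `m`, hence `e⁻² / m` after scaling. Slutsky's theorem, used once for `m̂ → m` in
probability and once for the ratio, concludes. -/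

namespace Seismic

/-! ### Sup distance between exponential distribution functions -/

/-- The supremum distance between the exponential CDFs of rates `a` and `x`. -/
noncomputable def expCDFDist (a x : ℝ) : ℝ :=
  ⨆ h : ℝ≥0, |(1 - Real.exp (-(x * h))) - (1 - Real.exp (-(a * h)))|

lemma expCDFDist_comm (a x : ℝ) : expCDFDist a x = expCDFDist x a := by
  simp only [expCDFDist, abs_sub_comm]

lemma expCDFDist_self (a : ℝ) : expCDFDist a a = 0 := by
  simp [expCDFDist]

lemma abs_exp_sub_exp_le {a x : ℝ} (ha : 0 < a) (hax : a ≤ x) (h : ℝ≥0) :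
    |(1 - Real.exp (-(x * h))) - (1 - Real.exp (-(a * h)))| ≤ (x - a) * (Real.exp (-1) / a) := by
  have h0 : (0 : ℝ) ≤ h := h.2
  have h1 : Real.exp (-(x * h)) ≤ Real.exp (-(a * h)) := by gcongr
  rw [abs_of_nonneg (by linarith)]
  have h2 : Real.exp (-(x * h)) = Real.exp (-(a * h)) * Real.exp (-((x - a) * h)) := by
    rw [← Real.exp_add]; ring_nf
  have h3 := Real.add_one_le_exp (-((x - a) * h))
  -- This is `y * exp (-y) ≤ exp (-1)`, the source of the constant `e⁻¹`.
  have h4 : a * h * Real.exp (-(a * h)) ≤ Real.exp (-1) := by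
    have := Real.add_one_le_exp (a * h - 1)
    calc a * h * Real.exp (-(a * h)) ≤ Real.exp (a * h - 1) * Real.exp (-(a * h)) := by
          gcongr; linarith
      _ = Real.exp (-1) := by rw [← Real.exp_add]; ring_nf
  have h5 : h * Real.exp (-(a * h)) ≤ Real.exp (-1) / a := by
    rw [le_div_iff₀ ha]; linarith
  calc _ = Real.exp (-(a * h)) * (1 - Real.exp (-((x - a) * h))) := by rw [h2]; ring
    _ ≤ Real.exp (-(a * h)) * ((x - a) * h) := by
        gcongr; linarith
    _ = (x - a) * (h * Real.exp (-(a * h))) := by ring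
    _ ≤ _ := by
        have : 0 ≤ x - a := by linarith
        gcongr

lemma expCDFDist_le {a x : ℝ} (ha : 0 < a) (hax : a ≤ x) :
    expCDFDist a x ≤ (x - a) * (Real.exp (-1) / a) :=
  ciSup_le (abs_exp_sub_exp_le ha hax)

lemma le_expCDFDist {a x : ℝ} (ha : 0 < a) (hax : a ≤ x) :
    (x - a) * (Real.exp (-1) / x) ≤ expCDFDist a x := by
  have hx : 0 < x := ha.trans_le hax
  -- Test the supremum at `h = 1 / x`, where `h * exp (-(x * h))` is maximal.
  refine le_trans ?_ (le_ciSup (f := fun h : ℝ≥0 =>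
    |(1 - Real.exp (-(x * h))) - (1 - Real.exp (-(a * h)))|)
    ⟨_, Set.forall_mem_range.2 (abs_exp_sub_exp_le ha hax)⟩ x⁻¹.toNNReal)
  refine le_trans ?_ (le_abs_self _)
  have h1 := Real.add_one_le_exp (1 - a / x)
  have h2 : Real.exp (-(a * x⁻¹)) = Real.exp (-1) * Real.exp (1 - a / x) := by
    rw [← Real.exp_add]; congr 1; ring
  rw [Real.coe_toNNReal _ (inv_nonneg.2 hx.le), mul_inv_cancel₀ hx.ne', h2]
  have h3 : (x - a) * (Real.exp (-1) / x) = Real.exp (-1) * (1 - a / x) := by field_simp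
  rw [h3]
  nlinarith [Real.exp_pos (-1)]

/-- The ratio of `expCDFDist a x` and its linearization `exp (-1) / a * |x - a|` at `a`. -/
noncomputable def expCDFDistRatio (a x : ℝ) : ℝ :=
  -- The value `1` makes the ratio continuous at `a`, so that limits can be taken along the full
  -- neighbourhood filter.
  if x = a then 1 else expCDFDist a x / (Real.exp (-1) / a * |x - a|)

/-- This is pure division, so it needs no sign condition on `x`, even for `x < 0`, where the
supremum is unbounded and defaults to `0`. -/
lemma expCDFDist_eq_mul_ratio {a : ℝ} (ha : 0 < a) (x : ℝ) :
    expCDFDist a x = |Real.exp (-1) / a * (x - a)| * expCDFDistRatio a x := by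
  by_cases hx : x = a
  · simp [hx, expCDFDist_self]
  · have : |x - a| ≠ 0 := by simpa [sub_eq_zero] using hx
    have h1 : 0 < Real.exp (-1) / a := by positivity
    rw [expCDFDistRatio, if_neg hx, abs_mul, abs_of_pos h1, mul_div_cancel₀]
    positivity

lemma expCDFDistRatio_mem {a x : ℝ} (ha : 0 < a) (hx : 0 < x) :
    min 1 (a / x) ≤ expCDFDistRatio a x ∧ expCDFDistRatio a x ≤ max 1 (a / x) := by
  rcases lt_trichotomy x a with h | rfl | h
  · have hp : 0 < a - x := by linarith
    have h1 := expCDFDist_le hx h.le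
    have h2 := le_expCDFDist hx h.le
    have hd : 0 < Real.exp (-1) / a * (a - x) := by positivity
    rw [expCDFDistRatio, if_neg h.ne, abs_sub_comm, abs_of_pos hp, expCDFDist_comm]
    constructor
    · refine (min_le_left _ _).trans ?_
      rw [le_div_iff₀ hd]; linarith
    · refine le_trans ?_ (le_max_right _ _)
      rw [div_le_iff₀ hd]
      refine h1.trans (le_of_eq ?_)
      field_simp
  · simp [expCDFDistRatio]
  · have hp : 0 < x - a := by linarith
    have h1 := expCDFDist_le ha h.le
    have h2 := le_expCDFDist ha h.le
    have hd : 0 < Real.exp (-1) / a * (x - a) := by positivity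
    rw [expCDFDistRatio, if_neg h.ne', abs_of_pos hp]
    constructor
    · refine (min_le_right _ _).trans ?_
      rw [le_div_iff₀ hd]
      refine le_trans (le_of_eq ?_) h2
      field_simp
    · refine le_trans ?_ (le_max_left _ _)
      rw [div_le_iff₀ hd]; linarith

lemma tendsto_expCDFDistRatio {a : ℝ} (ha : 0 < a) :
    Tendsto (expCDFDistRatio a) (𝓝 a) (𝓝 1) := by
  have h : Tendsto (fun x => a / x) (𝓝 a) (𝓝 1) := by
    have := (tendsto_const_nhds (x := a)).div (tendsto_id (x := 𝓝 a)) ha.ne'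
    rwa [div_self ha.ne'] at this
  have hl : Tendsto (fun x => min 1 (a / x)) (𝓝 a) (𝓝 1) := by
    simpa using (tendsto_const_nhds (x := (1 : ℝ))).min h
  have hu : Tendsto (fun x => max 1 (a / x)) (𝓝 a) (𝓝 1) := by
    simpa using (tendsto_const_nhds (x := (1 : ℝ))).max h
  refine tendsto_of_tendsto_of_tendsto_of_le_of_le' hl hu ?_ ?_ <;>
    filter_upwards [lt_mem_nhds ha] with x hx
  exacts [(expCDFDistRatio_mem ha hx).1, (expCDFDistRatio_mem ha hx).2]

/-! ### Truncated exponential series and jump times -/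

/-- The truncated exponential series `∑_{j < k} x ^ j / j!`. -/
noncomputable def truncExp (k : ℕ) (x : ℝ) : ℝ := ∑ j ∈ Finset.range k, x ^ j / j.factorial

lemma one_le_truncExp {k : ℕ} (hk : 1 ≤ k) {x : ℝ} (hx : 0 ≤ x) : 1 ≤ truncExp k x := by
  have := Finset.single_le_sum (f := fun j : ℕ => x ^ j / j.factorial)
    (fun j _ => by positivity) (Finset.mem_range.2 hk)
  rw [truncExp]
  simpa using this

lemma tendsto_exp_neg_mul_truncExp (k : ℕ) :
    Tendsto (fun x => Real.exp (-x) * truncExp k x) atTop (𝓝 0) := by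
  have : Tendsto (fun x => ∑ j ∈ Finset.range k, x ^ j * Real.exp (-x) / j.factorial) atTop
      (𝓝 (∑ j ∈ Finset.range k, 0 / (j.factorial : ℝ))) :=
    tendsto_finsetSum _ fun j _ => (Real.tendsto_pow_mul_exp_neg_atTop_nhds_zero j).div_const _
  simp only [zero_div, Finset.sum_const_zero] at this
  refine this.congr fun x => ?_
  rw [truncExp, Finset.mul_sum]
  exact Finset.sum_congr rfl fun j _ => by ring

/-- Each monomial grows by a factor between `1` and `(1 + c / x) ^ k`. -/
lemma tendsto_truncExp_add_div {k : ℕ} (hk : 1 ≤ k) {c : ℝ} (hc : 0 ≤ c) :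
    Tendsto (fun x => truncExp k (x + c) / truncExp k x) atTop (𝓝 1) := by
  have hu : Tendsto (fun x : ℝ => (1 + c / x) ^ k) atTop (𝓝 1) := by
    have := ((tendsto_const_nhds (x := (1 : ℝ))).add
      ((tendsto_const_nhds (x := c)).div_atTop tendsto_id)).pow k
    simpa using this
  refine tendsto_of_tendsto_of_tendsto_of_le_of_le' tendsto_const_nhds hu ?_ ?_ <;>
    filter_upwards [eventually_gt_atTop 0] with x hx
  · rw [le_div_iff₀ (one_pos.trans_le (one_le_truncExp hk hx.le)), one_mul]
    unfold truncExp
    gcongr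
    linarith
  · rw [div_le_iff₀ (one_pos.trans_le (one_le_truncExp hk hx.le)), truncExp, truncExp,
      Finset.mul_sum]
    refine Finset.sum_le_sum fun j hj => ?_
    have h1 : x + c = (1 + c / x) * x := by field_simp
    have h2 : (1 : ℝ) ≤ 1 + c / x := by
      have : 0 ≤ c / x := by positivity
      linarith
    rw [h1, mul_pow, mul_div_assoc]
    gcongr
    exact (Finset.mem_range.1 hj).le

/-- An integer-valued right-continuous path is constant just after `t`, so the infimum is attained.
`hk` excludes `sInf ∅ = 0`. -/
lemma jumpTime_le_iff {Ω : Type*} {N : ℝ≥0 → Ω → ℕ} {ω : Ω} (hmono : Monotone fun t => N t ω)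
    (hrc : ∀ t, ContinuousWithinAt (fun s => N s ω) (Set.Ici t) t) {k : ℕ}
    (hk : ∃ t, k ≤ N t ω) (t : ℝ≥0) : jumpTime N k ω ≤ t ↔ k ≤ N t ω := by
  refine ⟨fun h => ?_, fun h => csInf_le (OrderBot.bddBelow _) h⟩
  have hev : ∀ᶠ s in 𝓝[≥] t, N s ω = N t ω := by
    have := hrc t
    rw [ContinuousWithinAt, nhds_discrete, tendsto_pure] at this
    exact this
  obtain ⟨u, hu, hsub⟩ := (mem_nhdsGE_iff_exists_Ico_subset' (lt_add_one t)).1 hev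
  obtain ⟨s, hs, hsu⟩ := exists_lt_of_csInf_lt (s := {t | k ≤ N t ω}) hk (h.trans_lt hu)
  rcases le_total s t with hst | hst
  · exact le_trans hs (hmono hst)
  · exact le_trans hs (hsub ⟨hst, hsu⟩).le

/-! ### Residual law of the jump times -/

section

variable {Ω : Type*} [MeasurableSpace Ω] {μ : Measure Ω}
  {lam : ℝ≥0 → ℝ≥0} {N : ℝ≥0 → Ω → ℕ}

lemma cumIntensity_coe (lam : ℝ≥0 → ℝ≥0) (t : ℝ≥0) :
    (cumIntensity lam t : ℝ) = ∫ u in (0 : ℝ)..(t : ℝ), (lam u.toNNReal : ℝ) :=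
  Real.coe_toNNReal _ (intervalIntegral.integral_nonneg t.2 fun _ _ => NNReal.coe_nonneg _)

lemma cumIntensity_eq_add (hlam : Continuous lam) {m τs : ℝ≥0}
    (hconst : ∀ t, τs ≤ t → lam t = m) {t : ℝ≥0} (ht : τs ≤ t) :
    (cumIntensity lam t : ℝ) = cumIntensity lam τs + m * (t - τs) := by
  have hc : Continuous fun u : ℝ => (lam u.toNNReal : ℝ) := by fun_prop
  rw [cumIntensity_coe, cumIntensity_coe, ← intervalIntegral.integral_add_adjacent_intervals
    (hc.intervalIntegrable 0 τs) (hc.intervalIntegrable τs t)]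
  congr 1
  have : ∫ u in (τs : ℝ)..t, (lam u.toNNReal : ℝ) = ∫ _ in (τs : ℝ)..t, (m : ℝ) := by
    refine intervalIntegral.integral_congr fun u hu => ?_
    rw [Set.uIcc_of_le (NNReal.coe_le_coe.2 ht)] at hu
    exact congrArg _ (hconst _ (NNReal.le_toNNReal_of_coe_le hu.1))
  rw [this]
  simp [mul_comm]

lemma tendsto_cumIntensity (hlam : Continuous lam) {m τs : ℝ≥0} (hm : 0 < m)
    (hconst : ∀ t, τs ≤ t → lam t = m) :
    Tendsto (fun t => (cumIntensity lam t : ℝ)) atTop atTop := by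
  have h : Tendsto (fun t : ℝ≥0 => (cumIntensity lam τs : ℝ) + m * ((t : ℝ) + (-(τs : ℝ))))
      atTop atTop :=
    tendsto_atTop_add_const_left _ _ ((tendsto_atTop_add_const_right _ _
      (NNReal.tendsto_coe_atTop.2 tendsto_id)).const_mul_atTop (NNReal.coe_pos.2 hm))
  refine h.congr' ?_
  filter_upwards [eventually_ge_atTop τs] with t ht
  rw [cumIntensity_eq_add hlam hconst ht, sub_eq_add_neg]

lemma IsPoissonProcess.hasLaw (hN : IsPoissonProcess N lam μ) (t : ℝ≥0) :
    HasLaw (N t) (poissonMeasure (cumIntensity lam t)) μ := by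
  have h := hN.increment_law 0 t zero_le
  have h0 : cumIntensity lam 0 = 0 := by simp [cumIntensity]
  rw [h0, tsub_zero] at h
  refine h.congr ?_
  filter_upwards [hN.zero] with ω hω
  simp [hω]

lemma poissonMeasure_real_lt (r : ℝ≥0) (k : ℕ) :
    (poissonMeasure r).real {n | n < k} = Real.exp (-r) * truncExp k r := by
  have : {n : ℕ | n < k} = ((Finset.range k : Finset ℕ) : Set ℕ) := by ext; simp
  rw [this, ← sum_measureReal_singleton, truncExp, Finset.mul_sum]
  refine Finset.sum_congr rfl fun j _ => ?_
  rw [poissonMeasure_real_singleton, mul_div_assoc]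

lemma IsPoissonProcess.measureReal_lt (hN : IsPoissonProcess N lam μ) (k : ℕ) (t : ℝ≥0) :
    μ.real {ω | N t ω < k} =
      Real.exp (-cumIntensity lam t) * truncExp k (cumIntensity lam t) := by
  rw [← poissonMeasure_real_lt]
  exact (hN.hasLaw t).measureReal_eq (p := (· < k)) (MeasurableSet.of_discrete)

lemma IsPoissonProcess.ae_exists_le [IsProbabilityMeasure μ] (hN : IsPoissonProcess N lam μ)
    (hΛ : Tendsto (fun t => (cumIntensity lam t : ℝ)) atTop atTop) (k : ℕ) :
    ∀ᵐ ω ∂μ, ∃ t, k ≤ N t ω := by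
  have h := (tendsto_exp_neg_mul_truncExp k).comp hΛ
  have h0 : μ.real {ω | ¬ ∃ t, k ≤ N t ω} ≤ 0 := by
    refine ge_of_tendsto' h fun t => ?_
    rw [Function.comp_apply, ← hN.measureReal_lt k t]
    refine measureReal_mono fun ω hω => ?_
    simp only [Set.mem_ofPred_eq, not_exists, not_le] at hω ⊢
    exact hω t
  exact (measureReal_eq_zero_iff).1 (le_antisymm h0 measureReal_nonneg)

lemma IsPoissonProcess.lt_jumpTime_ae_eq [IsProbabilityMeasure μ] (hN : IsPoissonProcess N lam μ)
    (hΛ : Tendsto (fun t => (cumIntensity lam t : ℝ)) atTop atTop) (k : ℕ) (t : ℝ≥0) :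
    {ω | t < jumpTime N k ω} =ᵐ[μ] {ω | N t ω < k} := by
  rw [eventuallyEq_set]
  filter_upwards [hN.monotone, hN.rightContinuous, hN.ae_exists_le hΛ k] with ω h1 h2 h3
  simpa using not_congr (jumpTime_le_iff h1 h2 h3 t)

lemma IsPoissonProcess.residualCDF_jumpTime [IsProbabilityMeasure μ] (hN : IsPoissonProcess N lam μ)
    (hΛ : Tendsto (fun t => (cumIntensity lam t : ℝ)) atTop atTop) {k : ℕ} (hk : 1 ≤ k)
    (t h : ℝ≥0) :
    residualCDF μ (jumpTime N k) t h = 1 -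
      Real.exp (-(cumIntensity lam (t + h) - cumIntensity lam t)) *
        (truncExp k (cumIntensity lam (t + h)) / truncExp k (cumIntensity lam t)) := by
  -- Jump times are controlled only almost surely, so their tail events are only null measurable.
  have hmeas : ∀ s, NullMeasurableSet {ω | s < jumpTime N k ω} μ := fun s =>
    ((measurableSet_lt (hN.measurable s) measurable_const).nullMeasurableSet).congr
      (hN.lt_jumpTime_ae_eq hΛ k s).symm
  have hval : ∀ s, μ.real {ω | s < jumpTime N k ω} =
      Real.exp (-cumIntensity lam s) * truncExp k (cumIntensity lam s) := fun s => by
    rw [← hN.measureReal_lt, measureReal_congr (hN.lt_jumpTime_ae_eq hΛ k s)]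
  have hdiff : {ω | t < jumpTime N k ω ∧ jumpTime N k ω ≤ t + h} =
      {ω | t < jumpTime N k ω} \ {ω | t + h < jumpTime N k ω} := by
    ext ω; simp
  have hsub : {ω | t + h < jumpTime N k ω} ⊆ {ω | t < jumpTime N k ω} :=
    fun ω (hω : t + h < jumpTime N k ω) => lt_of_le_of_lt (le_self_add : t ≤ t + h) hω
  have hpos : 0 < truncExp k (cumIntensity lam t) :=
    one_pos.trans_le (one_le_truncExp hk (NNReal.coe_nonneg _))
  have h1 : μ.real ({ω | t < jumpTime N k ω} \ {ω | t + h < jumpTime N k ω}) =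
      μ.real {ω | t < jumpTime N k ω} - μ.real {ω | t + h < jumpTime N k ω} := by
    rw [eq_sub_iff_add_eq, ← measureReal_union₀ (hmeas _)
      (Set.disjoint_sdiff_left.aedisjoint), Set.sdiff_union_of_subset hsub]
  rw [residualCDF, hdiff, ProbabilityTheory.cond, measureReal_def, Measure.smul_apply,
    Measure.restrict_apply₀' (hmeas t), Set.inter_eq_left.2 Set.sdiff_subset, smul_eq_mul,
    ENNReal.toReal_mul, ENNReal.toReal_inv, ← measureReal_def, ← measureReal_def, h1, hval, hval,
    neg_sub, sub_eq_add_neg (cumIntensity lam t : ℝ), Real.exp_add,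
    Real.exp_neg (cumIntensity lam t : ℝ)]
  have := Real.exp_pos (cumIntensity lam t : ℝ)
  field_simp

/-- The residual waiting time of every jump time is asymptotically exponential. -/
theorem IsPoissonProcess.tendsto_residualCDF [IsProbabilityMeasure μ] (hN : IsPoissonProcess N lam μ)
    (hlam : Continuous lam) {k : ℕ} (hk : 1 ≤ k) {m τs : ℝ≥0} (hm : 0 < m)
    (hconst : ∀ t, τs ≤ t → lam t = m) (h : ℝ≥0) :
    Tendsto (fun t => residualCDF μ (jumpTime N k) t h) atTop
      (𝓝 (1 - Real.exp (-((m : ℝ) * h)))) := by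
  have hΛ := tendsto_cumIntensity hlam hm hconst
  have key := ((tendsto_truncExp_add_div hk (c := m * h) (by positivity)).comp hΛ).const_mul
    (Real.exp (-((m : ℝ) * h)))
  rw [mul_one] at key
  refine (key.const_sub 1).congr' ?_
  filter_upwards [eventually_ge_atTop τs] with t ht
  have hadd : (cumIntensity lam (t + h) : ℝ) = cumIntensity lam t + m * h := by
    rw [cumIntensity_eq_add hlam hconst ht,
      cumIntensity_eq_add hlam hconst (ht.trans le_self_add)]
    push_cast
    ring
  rw [hN.residualCDF_jumpTime hΛ hk, hadd, add_sub_cancel_left]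
  rfl

end

/-! ### Normal approximation of Poisson variables -/

lemma charFun_map_const_mul_sub {Ω : Type*} [MeasurableSpace Ω] {μ : Measure Ω}
    {X : Ω → ℕ} {r : ℝ≥0} (hX : HasLaw X (poissonMeasure r) μ) (a t : ℝ) :
    charFun (μ.map fun ω => a * ((X ω : ℝ) - r)) t =
      Complex.exp (r * (Complex.exp (a * t * Complex.I) - 1 - a * t * Complex.I)) := by
  have hm : AEMeasurable (fun ω => (X ω : ℝ)) μ :=
    (measurable_of_countable (fun n : ℕ => (n : ℝ))).comp_aemeasurable hX.aemeasurable
  have h1 : μ.map (fun ω => (X ω : ℝ)) = (poissonMeasure r).map (Nat.cast : ℕ → ℝ) := by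
    rw [← hX.map_eq, AEMeasurable.map_map_of_aemeasurable
      (measurable_of_countable _).aemeasurable hX.aemeasurable]
    rfl
  have h2 : (fun ω => a * ((X ω : ℝ) - r)) = fun ω => a * (X ω : ℝ) + (-(a * r)) := by
    ext; ring
  have h3 : μ.map (fun ω => a * (X ω : ℝ) + (-(a * r))) =
      (μ.map (fun ω => a * (X ω : ℝ))).map (fun x => x + (-(a * r))) := by
    rw [AEMeasurable.map_map_of_aemeasurable (by fun_prop) (by fun_prop)]
    rfl
  rw [h2, h3, charFun_map_add_const, charFun_map_mul_comp hm, h1,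
    charFun_map_cast_poissonMeasure, ← Complex.exp_add]
  congr 1
  simp
  ring

/-- By Taylor expansion, the quadratic term carries the limit, and the cubic remainder is at most
`|r a²| t² |a t|`, which vanishes with `a`. -/
lemma tendsto_poisson_charFun_exponent {r a : ℕ → ℝ} (ha : Tendsto a atTop (𝓝 0)) {v : ℝ}
    (hv : Tendsto (fun n => r n * a n ^ 2) atTop (𝓝 v)) (t : ℝ) :
    Tendsto (fun n => (r n : ℂ) *
      (Complex.exp (a n * t * Complex.I) - 1 - a n * t * Complex.I)) atTop
      (𝓝 (-(v * t ^ 2 / 2))) := by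
  have hmain : Tendsto (fun n => -(((r n * a n ^ 2 : ℝ) : ℂ) * t ^ 2 / 2)) atTop
      (𝓝 (-((v : ℂ) * t ^ 2 / 2))) :=
    ((((Complex.continuous_ofReal.tendsto v).comp hv).mul_const _).div_const _).neg
  refine hmain.congr_dist ?_
  have hat : Tendsto (fun n => |a n * t|) atTop (𝓝 0) := by
    simpa using (ha.mul_const t).abs
  have hb : Tendsto (fun n => |r n * a n ^ 2| * t ^ 2 * |a n * t|) atTop (𝓝 0) := by
    simpa using (hv.abs.mul_const (t ^ 2)).mul hat
  refine squeeze_zero' (Eventually.of_forall fun n => dist_nonneg) ?_ hb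
  filter_upwards [hat.eventually_le_const one_pos] with n hn
  set z : ℂ := a n * t * Complex.I with hz
  have hzn : ‖z‖ = |a n * t| := by simp [hz, abs_mul]
  have h1 := Complex.exp_bound (x := z) (by rw [hzn]; exact hn) (n := 3) (by norm_num)
  have h2 : z ^ 2 = -((a n : ℂ) ^ 2 * t ^ 2) := by
    rw [hz, mul_pow, Complex.I_sq]; ring
  have h3 : ((Nat.factorial 2 : ℕ) : ℂ) = 2 := by norm_num [Nat.factorial]
  have h4 : (r n : ℂ) * (Complex.exp z - 1 - z) - -(((r n * a n ^ 2 : ℝ) : ℂ) * t ^ 2 / 2) =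
      r n * (Complex.exp z - ∑ m ∈ Finset.range 3, z ^ m / m.factorial) := by
    simp only [Finset.sum_range_succ, Finset.range_zero, Finset.sum_empty, h2, h3]
    push_cast
    simp
    ring
  rw [dist_comm, dist_eq_norm, h4, norm_mul, Complex.norm_real, Real.norm_eq_abs]
  calc _ ≤ |r n| * (‖z‖ ^ 3 * 1) := by
        refine mul_le_mul_of_nonneg_left (h1.trans ?_) (abs_nonneg _)
        gcongr
        norm_num [Nat.factorial]
    _ = _ := by
        rw [hzn, pow_succ, sq_abs, abs_mul (r n), abs_of_nonneg (sq_nonneg (a n))]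
        ring

/-- Normal approximation of Poisson variables: affine images with vanishing slope whose variance
converges to `v` converge in distribution to the centered normal law with variance `v`. -/
theorem tendstoInDistribution_poisson {Ω : Type*} [MeasurableSpace Ω] {μ : Measure Ω}
    [IsProbabilityMeasure μ] {ι : Type*} {l : Filter ι} [l.IsCountablyGenerated]
    {X : ι → Ω → ℕ} {r : ι → ℝ≥0} {a : ι → ℝ} {v : ℝ≥0} {Y : ι → Ω → ℝ}
    (hY : ∀ i, AEMeasurable (Y i) μ)
    (hX : ∀ᶠ i in l, HasLaw (X i) (poissonMeasure (r i)) μ)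
    (hXY : ∀ᶠ i in l, Y i =ᵐ[μ] fun ω => a i * ((X i ω : ℝ) - r i))
    (ha : Tendsto a l (𝓝 0)) (hv : Tendsto (fun i => (r i : ℝ) * a i ^ 2) l (𝓝 v)) :
    TendstoInDistribution Y l id (fun _ => μ) (gaussianReal 0 v) := by
  refine ⟨hY, aemeasurable_id, ?_⟩
  refine tendsto_of_seq_tendsto fun u hu => ?_
  refine ProbabilityMeasure.tendsto_iff_tendsto_charFun.2 fun t => ?_
  simp only [Measure.map_id, ProbabilityMeasure.coe_mk, charFun_gaussianReal]
  have h := (Complex.continuous_exp.tendsto _).comp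
    (tendsto_poisson_charFun_exponent (ha.comp hu) (hv.comp hu) t)
  have he : Complex.exp (t * ((0 : ℝ) : ℂ) * Complex.I - ((v : ℝ≥0) : ℝ) * t ^ 2 / 2) =
    Complex.exp (-(((v : ℝ) : ℂ) * t ^ 2 / 2)) := by simp
  rw [he]
  refine h.congr' ?_
  filter_upwards [hu.eventually hX, hu.eventually hXY] with n h1 h2
  change _ = charFun (μ.map (Y (u n))) t
  rw [Measure.map_congr h2, charFun_map_const_mul_sub h1]
  rfl

/-! ### Convergence in probability to a constant -/

/-- Convergence in distribution to a constant implies convergence in probability. -/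
theorem tendstoInMeasure_of_tendstoInDistribution_const {Ω Ω' : Type*} [MeasurableSpace Ω]
    [MeasurableSpace Ω'] {μ : Measure Ω} [IsProbabilityMeasure μ] {μ' : Measure Ω'}
    [IsProbabilityMeasure μ'] {ι : Type*} {l : Filter ι} {X : ι → Ω → ℝ} {c : ℝ}
    (h : TendstoInDistribution X l (fun _ => c) (fun _ => μ) μ') :
    TendstoInMeasure μ X l (fun _ => c) := by
  rw [tendstoInMeasure_iff_measureReal_norm]
  intro ε hε
  have hclosed : IsClosed {x : ℝ | ε ≤ ‖x - c‖} := isClosed_le (by fun_prop) (by fun_prop)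
  have hnot : c ∉ {x : ℝ | ε ≤ ‖x - c‖} := by simpa using hε
  have h0 : ∀ s : Set ℝ, s ⊆ {x : ℝ | ε ≤ ‖x - c‖} → μ'.map (fun _ => c) s = 0 := by
    intro s hs
    refine measure_mono_null hs ?_
    rw [Measure.map_apply measurable_const hclosed.measurableSet]
    simp [hε.not_ge]
  -- Portmanteau: the closed set, and so its frontier, misses the atom `c`.
  have key := ProbabilityMeasure.tendsto_measure_of_null_frontier_of_tendsto' h.tendsto
    (E := {x : ℝ | ε ≤ ‖x - c‖}) (h0 _ hclosed.frontier_subset)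
  simp only [ProbabilityMeasure.coe_mk] at key
  rw [h0 _ subset_rfl] at key
  have := (ENNReal.tendsto_toReal ENNReal.zero_ne_top).comp key
  refine this.congr fun i => ?_
  simp only [Function.comp_apply, Measure.real]
  rw [Measure.map_apply_of_aemeasurable (h.forall_aemeasurable i) hclosed.measurableSet]
  rfl

/-- Convergence in probability to a constant is preserved by maps continuous at that constant. -/
lemma tendstoInMeasure_comp_of_tendsto {Ω : Type*} [MeasurableSpace Ω] {μ : Measure Ω}
    {ι : Type*} {l : Filter ι} {X : ι → Ω → ℝ} {c d : ℝ} {g : ℝ → ℝ}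
    (h : TendstoInMeasure μ X l (fun _ => c)) (hg : Tendsto g (𝓝 c) (𝓝 d)) :
    TendstoInMeasure μ (fun i ω => g (X i ω)) l (fun _ => d) := by
  rw [tendstoInMeasure_iff_dist] at h ⊢
  intro ε hε
  obtain ⟨δ, hδ, H⟩ := Metric.tendsto_nhds_nhds.1 hg ε hε
  refine tendsto_of_tendsto_of_tendsto_of_le_of_le tendsto_const_nhds (h δ hδ)
    (fun _ => zero_le) fun i => measure_mono fun ω hω => ?_
  by_contra hlt
  exact absurd (H (not_le.1 hlt)) (not_lt.2 hω)

lemma tendstoInMeasure_deterministic {Ω : Type*} [MeasurableSpace Ω] {μ : Measure Ω}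
    {ι : Type*} {l : Filter ι} {s : ι → ℝ} {c : ℝ} (h : Tendsto s l (𝓝 c)) :
    TendstoInMeasure μ (fun i _ => s i) l (fun _ => c) := by
  rw [tendstoInMeasure_iff_dist]
  intro ε hε
  refine tendsto_const_nhds.congr' ?_
  filter_upwards [Metric.tendsto_nhds.1 h ε hε] with i hi
  simp [hi.not_ge]

/-! ### Asymptotic normality of the slope estimator -/

section

variable {Ω : Type*} [MeasurableSpace Ω] {μ : Measure Ω}
  {lam : ℝ≥0 → ℝ≥0} {N : ℝ≥0 → Ω → ℕ}

/-- The estimator factors through the countable space `ℕ × ℕ`, so `f` is arbitrary; this spares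
proving `expCDFDistRatio` measurable. -/
lemma IsPoissonProcess.measurable_comp_slopeEstimator (hN : IsPoissonProcess N lam μ)
    (τs τ : ℝ≥0) (f : ℝ → ℝ) : Measurable fun ω => f (slopeEstimator N τs τ ω) :=
  (measurable_of_countable fun p : ℕ × ℕ =>
    f (((p.1 : ℝ) - p.2) / ((τ : ℝ) - τs))).comp ((hN.measurable τ).prodMk (hN.measurable τs))

lemma IsPoissonProcess.ae_slopeEstimator_nonneg (hN : IsPoissonProcess N lam μ) (τs : ℝ≥0) :
    ∀ᵐ ω ∂μ, ∀ τ, τs ≤ τ → 0 ≤ slopeEstimator N τs τ ω := by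
  filter_upwards [hN.monotone] with ω hω τ hτ
  have h1 : (N τs ω : ℝ) ≤ N τ ω := Nat.cast_le.2 (hω hτ)
  have h2 : (τs : ℝ) ≤ τ := NNReal.coe_le_coe.2 hτ
  exact div_nonneg (by linarith) (by linarith)

lemma abs_exp_cdf_sub_le_one {a x h : ℝ} (ha : 0 ≤ a) (hx : 0 ≤ x) (hh : 0 ≤ h) :
    |(1 - Real.exp (-(x * h))) - (1 - Real.exp (-(a * h)))| ≤ 1 := by
  have h1 : Real.exp (-(x * h)) ≤ 1 := Real.exp_le_one_iff.2 (by nlinarith [mul_nonneg hx hh])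
  have h2 : Real.exp (-(a * h)) ≤ 1 := Real.exp_le_one_iff.2 (by nlinarith [mul_nonneg ha hh])
  have h3 := Real.exp_pos (-(x * h))
  have h4 := Real.exp_pos (-(a * h))
  rw [abs_le]
  constructor <;> linarith

/-- The linearized estimation error `e⁻¹ / m * √τ * (m̂_τ - m)` is asymptotically normal. -/
theorem IsPoissonProcess.tendstoInDistribution_slopeEstimator [IsProbabilityMeasure μ]
    (hN : IsPoissonProcess N lam μ) (hlam : Continuous lam) {m τs : ℝ≥0} (hm : 0 < m)
    (hconst : ∀ t, τs ≤ t → lam t = m) :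
    TendstoInDistribution
      (fun (τ : ℝ≥0) ω =>
        √(τ : ℝ) * (Real.exp (-1) / m * (slopeEstimator N τs τ ω - m)))
      atTop id (fun _ => μ) (gaussianReal 0 (Real.toNNReal (Real.exp (-2) / m))) := by
  have hm' : (0 : ℝ) < m := NNReal.coe_pos.2 hm
  have hsub : Tendsto (fun τ : ℝ≥0 => (τ : ℝ) - τs) atTop atTop := by
    simpa only [sub_eq_add_neg, id] using
      tendsto_atTop_add_const_right atTop (-(τs : ℝ)) (NNReal.tendsto_coe_atTop.2 tendsto_id)
  have hratio : Tendsto (fun τ : ℝ≥0 => (τ : ℝ) / (τ - τs)) atTop (𝓝 1) := by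
    have h := ((tendsto_const_nhds (x := (τs : ℝ))).div_atTop hsub).const_add 1
    rw [add_zero] at h
    refine h.congr' ?_
    filter_upwards [hsub.eventually_gt_atTop 0] with τ hτ
    field_simp
    ring
  have hΛ : ∀ τ : ℝ≥0, τs ≤ τ →
      ((cumIntensity lam τ - cumIntensity lam τs : ℝ≥0) : ℝ) = m * (τ - τs) := fun τ hτ => by
    have h := cumIntensity_eq_add hlam hconst hτ
    have h2 : (τs : ℝ) ≤ τ := NNReal.coe_le_coe.2 hτ
    have h3 : cumIntensity lam τs ≤ cumIntensity lam τ := by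
      rw [← NNReal.coe_le_coe, h]
      nlinarith
    rw [NNReal.coe_sub h3, h]
    ring
  have hva : Tendsto (fun τ : ℝ≥0 =>
      ((cumIntensity lam τ - cumIntensity lam τs : ℝ≥0) : ℝ) *
        (√(τ : ℝ) * (Real.exp (-1) / m) / (τ - τs)) ^ 2) atTop
      (𝓝 (Real.toNNReal (Real.exp (-2) / m) : ℝ≥0)) := by
    rw [Real.coe_toNNReal _ (by positivity)]
    have h := hratio.const_mul (Real.exp (-2) / m)
    rw [mul_one] at h
    refine h.congr' ?_
    filter_upwards [hsub.eventually_gt_atTop 0] with τ hτ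
    have he : Real.exp (-2) = Real.exp (-1) ^ 2 := by rw [← Real.exp_nat_mul]; norm_num
    rw [hΛ τ (NNReal.coe_le_coe.1 (by linarith)), div_pow, mul_pow, Real.sq_sqrt τ.coe_nonneg, he]
    field_simp
  refine tendstoInDistribution_poisson (X := fun τ ω => N τ ω - N τs ω)
    (r := fun τ => cumIntensity lam τ - cumIntensity lam τs)
    (a := fun τ => √(τ : ℝ) * (Real.exp (-1) / m) / (τ - τs)) (fun τ => ?_) ?_ ?_ ?_ hva
  · exact (hN.measurable_comp_slopeEstimator τs τ
      fun x => √(τ : ℝ) * (Real.exp (-1) / m * (x - m))).aemeasurable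
  · filter_upwards [eventually_ge_atTop τs] with τ hτ
    exact hN.increment_law τs τ hτ
  -- Path monotonicity makes the truncated subtraction in `ℕ` a true difference.
  · filter_upwards [eventually_gt_atTop τs] with τ hτ
    filter_upwards [hN.monotone] with ω hω
    have h2 : (0 : ℝ) < τ - τs := sub_pos.2 (NNReal.coe_lt_coe.2 hτ)
    rw [hΛ τ hτ.le, Nat.cast_sub (hω hτ.le), slopeEstimator]
    field_simp
  · have hsq : Tendsto (fun τ : ℝ≥0 =>
        (Real.exp (-1) / m) ^ 2 * ((τ : ℝ) / (τ - τs)) / (τ - τs)) atTop (𝓝 0) :=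
      (hratio.const_mul _).div_atTop hsub
    have h := hsq.sqrt
    rw [Real.sqrt_zero] at h
    refine h.congr' ?_
    filter_upwards [hsub.eventually_gt_atTop 0] with τ hτ
    rw [Real.sqrt_eq_iff_eq_sq (by positivity) (by positivity), div_pow (√(τ : ℝ) * _),
      mul_pow (√(τ : ℝ)), Real.sq_sqrt τ.coe_nonneg]
    field_simp

end

end Seismic

/-! ### Assembly by Slutsky's theorem -/

theorem theorem6 {Ω : Type*} [MeasurableSpace Ω] (μ : Measure Ω) [IsProbabilityMeasure μ]
    (lam : ℝ≥0 → ℝ≥0) (hlam : Continuous lam)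
    (N : ℝ≥0 → Ω → ℕ) (hN : Seismic.IsPoissonProcess N lam μ)
    (k : ℕ) (hk : 1 ≤ k)
    (m : ℝ≥0) (hm : 0 < m) (τs : ℝ≥0) (hτs : 0 < τs) (hconst : ∀ t, τs ≤ t → lam t = m) :
    -- the limit defining `G = limitCDF μ T_k` exists and is the exponential CDF with rate `m`
    (∀ h : ℝ≥0,
      Tendsto (fun t : ℝ≥0 => Seismic.residualCDF μ (Seismic.jumpTime N k) t h) atTop
        (𝓝 (Seismic.limitCDF μ (Seismic.jumpTime N k) h)) ∧
      Seismic.limitCDF μ (Seismic.jumpTime N k) h = 1 - Real.exp (-((m : ℝ) * (h : ℝ)))) ∧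
    -- the supremum below is finite
    (∀ᵐ ω ∂μ, ∀ τ : ℝ≥0, τs < τ →
      BddAbove (Set.range fun h : ℝ≥0 =>
        |√(τ : ℝ) * (Seismic.randomCDF N τs τ h ω -
          Seismic.limitCDF μ (Seismic.jumpTime N k) h)|)) ∧
    -- its convergence in distribution
    TendstoInDistribution
      (fun (τ : ℝ≥0) ω => ⨆ h : ℝ≥0,
        |√(τ : ℝ) * (Seismic.randomCDF N τs τ h ω -
          Seismic.limitCDF μ (Seismic.jumpTime N k) h)|)
      atTop (fun x : ℝ => |x|) (fun _ => μ)
      (gaussianReal 0 (Real.toNNReal (Real.exp (-2) / (m : ℝ)))) := by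
  have hm' : (0 : ℝ) < m := NNReal.coe_pos.2 hm
  have hlim := fun h => hN.tendsto_residualCDF hlam hk hm hconst h
  have hG : ∀ h : ℝ≥0, Seismic.limitCDF μ (Seismic.jumpTime N k) h =
      1 - Real.exp (-((m : ℝ) * (h : ℝ))) := fun h => (hlim h).limUnder_eq
  simp only [hG]
  refine ⟨fun h => ⟨hlim h, trivial⟩, ?_, ?_⟩
  · filter_upwards [hN.ae_slopeEstimator_nonneg τs] with ω hω τ hτ
    refine ⟨√(τ : ℝ) * 1, Set.forall_mem_range.2 fun h => ?_⟩
    rw [abs_mul, abs_of_nonneg (Real.sqrt_nonneg _)]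
    exact mul_le_mul_of_nonneg_left
      (Seismic.abs_exp_cdf_sub_le_one hm'.le (hω τ hτ.le) h.2) (Real.sqrt_nonneg _)
  · have hY := hN.tendstoInDistribution_slopeEstimator hlam hm hconst
    set Y : ℝ≥0 → Ω → ℝ := fun τ ω =>
      √(τ : ℝ) * (Real.exp (-1) / m * (Seismic.slopeEstimator N τs τ ω - m)) with hYdef
    have hs : Tendsto (fun τ : ℝ≥0 => (√(τ : ℝ) * (Real.exp (-1) / m))⁻¹) atTop (𝓝 0) :=
      tendsto_inv_atTop_zero.comp ((Real.tendsto_sqrt_atTop.comp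
        (NNReal.tendsto_coe_atTop.2 tendsto_id)).atTop_mul_const (by positivity))
    -- Undoing the scaling of `Y` recovers `m̂`, so the vanishing factor `hs` yields `m̂ → m`.
    have hslope := hY.continuous_comp_prodMk_of_tendstoInMeasure_const
      (g := fun p : ℝ × ℝ => p.1 * p.2 + m) (by fun_prop)
      (Seismic.tendstoInMeasure_deterministic (μ := μ) hs) (fun _ => aemeasurable_const)
    simp only [mul_zero, zero_add] at hslope
    have hratio := Seismic.tendstoInMeasure_comp_of_tendsto
      (Seismic.tendstoInMeasure_of_tendstoInDistribution_const hslope)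
      (Seismic.tendsto_expCDFDistRatio hm')
    have hfinal := hY.continuous_comp_prodMk_of_tendstoInMeasure_const
      (g := fun p : ℝ × ℝ => |p.1| * p.2) (by fun_prop) hratio fun τ =>
        (hN.measurable_comp_slopeEstimator τs τ fun x => Seismic.expCDFDistRatio m
          (√(τ : ℝ) * (Real.exp (-1) / m * (x - m)) *
            (√(τ : ℝ) * (Real.exp (-1) / m))⁻¹ + m)).aemeasurable
    simp only [mul_one, id] at hfinal
    refine hfinal.congr (fun τ => Eventually.of_forall fun ω => ?_)
      (Eventually.of_forall fun _ => rfl)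
    simp only [abs_mul, abs_of_nonneg (Real.sqrt_nonneg (τ : ℝ))]
    rw [← Real.mul_iSup_of_nonneg (Real.sqrt_nonneg _)]
    change _ = √(τ : ℝ) * Seismic.expCDFDist m (Seismic.slopeEstimator N τs τ ω)
    rw [Seismic.expCDFDist_eq_mul_ratio hm', hYdef]
    -- At `τ = 0` the scaling cannot be undone, but both sides carry the factor `√0`.
    rcases eq_or_ne τ 0 with rfl | hτ
    · simp
    · have hτ' : √(τ : ℝ) ≠ 0 := (Real.sqrt_pos.2 (NNReal.coe_pos.2 (pos_iff_ne_zero.2 hτ))).ne'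
      have hc : √(τ : ℝ) * (Real.exp (-1) / m * (Seismic.slopeEstimator N τs τ ω - m)) *
          (√(τ : ℝ) * (Real.exp (-1) / m))⁻¹ + m = Seismic.slopeEstimator N τs τ ω := by
        field_simp
        ring
      simp only [hc]
      rw [abs_mul, abs_of_nonneg (Real.sqrt_nonneg (τ : ℝ)), mul_assoc]
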